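/- Let $\mu$ be the Möbius function, $\{t\}=t-\lfloor t\rfloor$ the fractional part of $t$, and $S(x)=\int_0^x\frac{\sin u}{u}\,du$ the sine integral. Then for every real number $a>0$, $$\int_0^\infty\frac{\{t\}-\frac12}{t}\left(\sum_{n\ge1}\frac{\mu(n)}{n}\left(e^{-t/(na)}-1\right)\right)dt=\frac1\pi\int_0^\infty S\!\left(\frac{x}{2\pi a}\right)e^{-x}\,dx.$$ Here the series converges absolutely for every $t>0$, the integral on the left converges as an improper integral $\lim_{T\to\infty}\int_0^T$ (with integrand integrable on each $[0,T]$), and the integral on the right converges absolutely. -/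

import Mathlib

open Filter Topology MeasureTheory

noncomputable section

/-- The sine integral `Si(x) = ∫₀ˣ sin u / u du`. -/
def sineIntegral (x : ℝ) : ℝ := ∫ u in (0 : ℝ)..x, Real.sin u / u

/-- The improper integral `∫₀^∞ f(t) dt` converges and has the value `I`: the function is integrable
on every interval `[0, T]`, and its integral over `[0, T]` tends to `I` as `T → ∞`. -/
def HasImproperIntegral (f : ℝ → ℝ) (I : ℝ) : Prop :=
  (∀ T : ℝ, 0 < T → IntervalIntegrable f volume 0 T) ∧
    Tendsto (fun T : ℝ => ∫ t in (0 : ℝ)..T, f t) atTop (𝓝 I)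

/-- The `n`-th term `(μ(n) / n) (e^{-t/(na)} - 1)` of the Möbius series, for `n ≥ 1`. -/
def moebiusExpTerm (a t : ℝ) (n : ℕ+) : ℝ :=
  (ArithmeticFunction.moebius (n : ℕ) : ℝ) / (n : ℝ) * (Real.exp (-t / ((n : ℝ) * a)) - 1)

end

/-!
The theorem says that both sides equal `arctan (1 / (2πa)) / π`.

For a single `c ≥ 0`, write `(1 - e^{-ct}) / t = ∫₀ᶜ e^{-ut} du` and exchange integrals, so that
`∫₀ᵀ ({t} - 1/2) / t * (e^{-ct} - 1) dt = -∫₀ᶜ J(u, T) du`, where `J(u, T)` is the Laplace transform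
of the sawtooth `{t} - 1/2` truncated to `[0, T]`
(`integral_sawtooth_div_mul_exp_sub_one`). By periodicity `J(u, T)` is, up to a partial period, a
geometric sum; this gives `|J(u, T)| ≤ 1` uniformly in `u > 0` and `T ≥ 0`
(`abs_truncatedLaplace_le_one`) and the limit `1 / u² - coth (u / 2) / (2u)` as `T → ∞`
(`tendsto_truncatedLaplace`), which by the partial fractions of `coth` equals
`-∑ₖ 2 / (u² + 4π²k²)` (`hasSum_two_div_sq_add`). Dominated convergence on `[0, c]` then shows that
the improper integral exists, is bounded by `c` at every stage `T`, and has the value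
`∑ₖ arctan (c / (2πk)) / (πk)`.

Take `c = 1 / (na)`. The uniform bound `c` makes the `n`-th term of the Möbius series contribute at
most `1 / (n²a)` for every `T`, so the limit `T → ∞` passes through the sum over `n`, although the
full integrand is not absolutely integrable. The result is the double sum
`∑ₙ ∑ₖ μ(n) f(nk)` with `f(m) = arctan (1 / (2πam)) / (πm)`, which collapses to `f(1)`
(`tsum_moebius_mul_tsum`).

On the other side, `Si(bx) = ∫₀ᵇ sin(vx) / v dv`, and Fubini turns `∫₀^∞ Si(bx) e^{-x} dx` into
`∫₀ᵇ dv / (1 + v²) = arctan b` (`integral_sineIntegral_mul_exp_neg`).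
-/

/-! ### The sawtooth and its truncated Laplace transform -/

/-- The centred sawtooth `{t} - 1/2`. -/
noncomputable def sawtooth (t : ℝ) : ℝ := Int.fract t - 1 / 2

/-- The Laplace transform at `u` of the sawtooth, truncated to `[0, T]`. -/
noncomputable def truncatedLaplace (u T : ℝ) : ℝ :=
  ∫ t in (0 : ℝ)..T, sawtooth t * Real.exp (-(u * t))

lemma measurable_sawtooth : Measurable sawtooth :=
  measurable_fract.sub_const _

lemma abs_sawtooth_le (t : ℝ) : |sawtooth t| ≤ 1 / 2 := by
  have h0 := Int.fract_nonneg t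
  have h1 := (Int.fract_lt_one t).le
  rw [sawtooth, abs_le]
  constructor <;> linarith

lemma sawtooth_add_nat (t : ℝ) (n : ℕ) : sawtooth (t + n) = sawtooth t := by
  simp [sawtooth]

lemma intervalIntegrable_sawtooth_mul {g : ℝ → ℝ} (hg : Continuous g) (a b : ℝ) :
    IntervalIntegrable (fun t => sawtooth t * g t) volume a b := by
  have h : IntervalIntegrable sawtooth volume a b :=
    (intervalIntegrable_const (c := (1 / 2 : ℝ))).mono_fun
      measurable_sawtooth.aestronglyMeasurable
      (Eventually.of_forall fun t => by
        simpa [Real.norm_eq_abs] using abs_sawtooth_le t)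
  exact h.mul_continuousOn hg.continuousOn

/-- On the unit interval the sawtooth is affine, away from the endpoint `1`. -/
lemma integral_sawtooth_mul_unit (g : ℝ → ℝ) :
    ∫ t in (0 : ℝ)..1, sawtooth t * g t = ∫ t in (0 : ℝ)..1, (t - 1 / 2) * g t := by
  apply intervalIntegral.integral_congr_ae
  have h1 : ∀ᵐ t : ℝ, t ≠ 1 := by simp [ae_iff]
  filter_upwards [h1] with t ht hmem
  rw [Set.uIoc_of_le zero_le_one] at hmem
  rw [sawtooth, Int.fract_eq_self.2 ⟨hmem.1.le, lt_of_le_of_ne hmem.2 ht⟩]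

lemma truncatedLaplace_one {u : ℝ} (hu : u ≠ 0) :
    truncatedLaplace u 1 =
      (1 - Real.exp (-u)) / u ^ 2 - (1 + Real.exp (-u)) / (2 * u) := by
  rw [truncatedLaplace, integral_sawtooth_mul_unit]
  have hderiv : ∀ t ∈ Set.uIcc (0 : ℝ) 1, HasDerivAt
      (fun t => -((t - 1 / 2) / u + 1 / u ^ 2) * Real.exp (-(u * t)))
      ((t - 1 / 2) * Real.exp (-(u * t))) t := by
    intro t _
    have h1 : HasDerivAt (fun t : ℝ => Real.exp (-(u * t))) (Real.exp (-(u * t)) * -(u * 1)) t :=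
      (((hasDerivAt_id t).const_mul u).neg).exp
    have h2 : HasDerivAt (fun t : ℝ => -((t - 1 / 2) / u + 1 / u ^ 2)) (-(1 / u)) t :=
      ((((hasDerivAt_id t).sub_const _).div_const u).add_const _).neg
    refine (h2.mul h1).congr_deriv ?_
    field_simp
    ring
  rw [intervalIntegral.integral_eq_sub_of_hasDerivAt hderiv
    (Continuous.intervalIntegrable (by fun_prop) _ _)]
  simp only [mul_zero, neg_zero, Real.exp_zero, mul_one]
  field_simp
  ring

/-- The sawtooth has mean zero over a period, so `exp (-u t)` may be replaced by
`exp (-u t) - exp (-u)`, which lies between `0` and `1 - exp (-u)`. -/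
lemma abs_truncatedLaplace_one_le {u : ℝ} (hu : 0 < u) :
    |truncatedLaplace u 1| ≤ (1 - Real.exp (-u)) / 2 := by
  have h0 : ∫ t in (0 : ℝ)..1, sawtooth t * Real.exp (-u) = 0 := by
    rw [integral_sawtooth_mul_unit, intervalIntegral.integral_mul_const]
    norm_num [integral_id]
  have h1 : truncatedLaplace u 1 =
      ∫ t in (0 : ℝ)..1, sawtooth t * (Real.exp (-(u * t)) - Real.exp (-u)) := by
    simp_rw [mul_sub]
    rw [intervalIntegral.integral_sub (intervalIntegrable_sawtooth_mul (by fun_prop) _ _)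
      (intervalIntegrable_sawtooth_mul (by fun_prop) _ _), h0, sub_zero, truncatedLaplace]
  rw [h1, ← Real.norm_eq_abs]
  have := intervalIntegral.norm_integral_le_of_norm_le_const (a := (0 : ℝ)) (b := 1)
    (C := (1 - Real.exp (-u)) / 2)
    (f := fun t => sawtooth t * (Real.exp (-(u * t)) - Real.exp (-u))) ?_
  · simpa using this
  intro t ht
  rw [Set.uIoc_of_le zero_le_one] at ht
  have ha : Real.exp (-u) ≤ Real.exp (-(u * t)) := Real.exp_le_exp.2 (by nlinarith [ht.2])
  have hb : Real.exp (-(u * t)) ≤ 1 := Real.exp_le_one_iff.2 (by nlinarith [ht.1])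
  rw [norm_mul, Real.norm_eq_abs, Real.norm_eq_abs, abs_of_nonneg (sub_nonneg.2 ha)]
  calc |sawtooth t| * (Real.exp (-(u * t)) - Real.exp (-u))
      ≤ 1 / 2 * (1 - Real.exp (-u)) := by
        apply mul_le_mul (abs_sawtooth_le t) _ (sub_nonneg.2 ha) (by norm_num)
        linarith
    _ = _ := by ring

/-- Each period contributes the first one scaled by a power of `exp (-u)`. -/
lemma truncatedLaplace_nat (u : ℝ) (N : ℕ) :
    truncatedLaplace u N = truncatedLaplace u 1 * ∑ n ∈ Finset.range N, Real.exp (-u) ^ n := by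
  induction N with
  | zero => simp [truncatedLaplace]
  | succ N ih =>
    have hshift : ∫ t in (N : ℝ)..(N + 1 : ℕ), sawtooth t * Real.exp (-(u * t)) =
        truncatedLaplace u 1 * Real.exp (-u) ^ N := by
      have h := intervalIntegral.integral_comp_add_right (a := 0) (b := 1)
        (fun t => sawtooth t * Real.exp (-(u * t))) (N : ℝ)
      rw [zero_add, add_comm (1 : ℝ)] at h
      push_cast
      rw [← h, truncatedLaplace, ← intervalIntegral.integral_mul_const]
      congr 1
      ext t
      rw [sawtooth_add_nat, ← Real.exp_nat_mul, mul_assoc, ← Real.exp_add]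
      ring_nf
    rw [Finset.sum_range_succ, mul_add, ← ih, ← hshift, truncatedLaplace, truncatedLaplace,
      intervalIntegral.integral_add_adjacent_intervals
        (intervalIntegrable_sawtooth_mul (by fun_prop) _ _)
        (intervalIntegrable_sawtooth_mul (by fun_prop) _ _)]

lemma abs_truncatedLaplace_sub_floor_le {u T : ℝ} (hu : 0 < u) (hT : 0 ≤ T) :
    |truncatedLaplace u T - truncatedLaplace u ⌊T⌋₊| ≤ Real.exp (-u) ^ ⌊T⌋₊ / 2 := by
  have hle := Nat.floor_le hT
  have hlt := Nat.lt_floor_add_one T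
  rw [truncatedLaplace, truncatedLaplace, intervalIntegral.integral_interval_sub_left
    (intervalIntegrable_sawtooth_mul (by fun_prop) _ _)
    (intervalIntegrable_sawtooth_mul (by fun_prop) _ _), ← Real.norm_eq_abs]
  refine (intervalIntegral.norm_integral_le_of_norm_le_const
    (C := Real.exp (-u) ^ ⌊T⌋₊ / 2) ?_).trans ?_
  · intro t ht
    rw [Set.uIoc_of_le hle] at ht
    rw [norm_mul, Real.norm_eq_abs, Real.norm_eq_abs, Real.abs_exp, ← Real.exp_nat_mul]
    have : Real.exp (-(u * t)) ≤ Real.exp (⌊T⌋₊ * -u) :=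
      Real.exp_le_exp.2 (by nlinarith [ht.1])
    calc |sawtooth t| * Real.exp (-(u * t)) ≤ 1 / 2 * Real.exp (⌊T⌋₊ * -u) :=
          mul_le_mul (abs_sawtooth_le t) this (Real.exp_pos _).le (by norm_num)
      _ = _ := by ring
  · apply mul_le_of_le_one_right (by positivity)
    rw [abs_of_nonneg (by linarith)]
    linarith

/-- A bound independent of both `u` and `T`. The geometric sum grows like `1 / u` as `u → 0`, which
the factor `1 - exp (-u)` in `abs_truncatedLaplace_one_le` absorbs. -/
lemma abs_truncatedLaplace_le_one {u T : ℝ} (hu : 0 < u) (hT : 0 ≤ T) :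
    |truncatedLaplace u T| ≤ 1 := by
  have hw : Real.exp (-u) < 1 := Real.exp_lt_one_iff.2 (by linarith)
  have hfl := abs_truncatedLaplace_sub_floor_le hu hT
  have hpow : Real.exp (-u) ^ ⌊T⌋₊ ≤ 1 := pow_le_one₀ (Real.exp_pos _).le hw.le
  have hnat : |truncatedLaplace u ⌊T⌋₊| ≤ 1 / 2 := by
    rw [truncatedLaplace_nat, abs_mul, abs_of_nonneg
      (Finset.sum_nonneg fun n _ => pow_nonneg (Real.exp_pos _).le n)]
    have hgeo := mul_neg_geom_sum (Real.exp (-u)) ⌊T⌋₊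
    have hpow0 : 0 ≤ Real.exp (-u) ^ ⌊T⌋₊ := by positivity
    calc _ ≤ (1 - Real.exp (-u)) / 2 * ∑ n ∈ Finset.range ⌊T⌋₊, Real.exp (-u) ^ n :=
          mul_le_mul_of_nonneg_right (abs_truncatedLaplace_one_le hu)
            (Finset.sum_nonneg fun n _ => pow_nonneg (Real.exp_pos _).le n)
      _ ≤ 1 / 2 := by linarith
  have := abs_add_le (truncatedLaplace u T - truncatedLaplace u ⌊T⌋₊) (truncatedLaplace u ⌊T⌋₊)
  rw [sub_add_cancel] at this
  linarith

lemma tendsto_truncatedLaplace {u : ℝ} (hu : 0 < u) :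
    Tendsto (truncatedLaplace u) atTop
      (𝓝 (1 / u ^ 2 - (1 + Real.exp (-u)) / (2 * u * (1 - Real.exp (-u))))) := by
  have hw : Real.exp (-u) < 1 := Real.exp_lt_one_iff.2 (by linarith)
  have hw0 := (Real.exp_pos (-u)).le
  have hnat : Tendsto (fun T : ℝ => truncatedLaplace u ⌊T⌋₊) atTop
      (𝓝 (truncatedLaplace u 1 * (1 - Real.exp (-u))⁻¹)) := by
    simp_rw [truncatedLaplace_nat]
    exact ((hasSum_geometric_of_lt_one hw0 hw).tendsto_sum_nat.comp
      tendsto_nat_floor_atTop).const_mul _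
  have herr : Tendsto (fun T : ℝ => truncatedLaplace u T - truncatedLaplace u ⌊T⌋₊) atTop
      (𝓝 0) := by
    apply squeeze_zero_norm' (a := fun T : ℝ => Real.exp (-u) ^ ⌊T⌋₊ / 2)
    · filter_upwards [eventually_ge_atTop 0] with T hT
      exact abs_truncatedLaplace_sub_floor_le hu hT
    · simpa using ((tendsto_pow_atTop_nhds_zero_of_lt_one hw0 hw).comp
        (tendsto_nat_floor_atTop (α := ℝ))).div_const 2
  have h := herr.add hnat
  simp only [sub_add_cancel, zero_add] at h
  convert h using 2
  rw [truncatedLaplace_one hu.ne']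
  have : 1 - Real.exp (-u) ≠ 0 := by linarith
  field_simp

/-! ### Partial fractions of the hyperbolic cotangent -/

lemma summable_two_div_sq_add (u : ℝ) :
    Summable fun k : ℕ+ => 2 / (u ^ 2 + (2 * Real.pi * k) ^ 2) := by
  have h : Summable fun k : ℕ+ => 2 / (2 * Real.pi) ^ 2 * (1 / ((k : ℕ) : ℝ) ^ 2) :=
    ((Real.summable_one_div_nat_pow.2 one_lt_two).comp_injective PNat.coe_injective).mul_left _
  refine h.of_nonneg_of_le (fun k => by positivity) fun k => ?_
  have hk : (0 : ℝ) < (k : ℕ) := by exact_mod_cast k.pos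
  have hp := Real.pi_pos
  rw [div_mul_div_comm, mul_one, ← mul_pow]
  gcongr
  nlinarith [sq_nonneg u]

/-- The partial fraction expansion of the hyperbolic cotangent, from that of the cotangent at
the point `i u / (2 π)`. -/
lemma hasSum_two_div_sq_add {u : ℝ} (hu : 0 < u) :
    HasSum (fun k : ℕ+ => 2 / (u ^ 2 + (2 * Real.pi * k) ^ 2))
      ((1 + Real.exp (-u)) / (2 * u * (1 - Real.exp (-u))) - 1 / u ^ 2) := by
  have hpi : (Real.pi : ℂ) ≠ 0 := by exact_mod_cast Real.pi_ne_zero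
  have huC : (u : ℂ) ≠ 0 := by exact_mod_cast hu.ne'
  have hw : (1 : ℂ) - Complex.exp (-u) ≠ 0 := by
    have : Real.exp (-u) < 1 := Real.exp_lt_one_iff.2 (by linarith)
    have h : (1 : ℝ) - Real.exp (-u) ≠ 0 := by linarith
    exact_mod_cast h
  set z : ℂ := Complex.I * u / (2 * Real.pi) with hz
  have hz' : z = Complex.I * ((u / (2 * Real.pi) : ℝ) : ℂ) := by rw [hz]; push_cast; ring
  have him : 0 < z.im := by
    rw [hz', Complex.im_mul_ofReal, Complex.I_im, one_mul]
    have := Real.pi_pos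
    positivity
  have hcot := cot_series_rep (UpperHalfPlane.coe_mem_integerComplement ⟨z, him⟩)
  simp only [] at hcot
  have hexp : Complex.exp (2 * Complex.I * (Real.pi * z)) = Complex.exp (-u) := by
    congr 1
    rw [hz]
    field_simp
    rw [Complex.I_sq]
  have hterm : ∀ k : ℕ+, 1 / (z - (k : ℕ)) + 1 / (z + (k : ℕ)) =
      (-(2 * Real.pi * Complex.I * u)) *
        ((2 / (u ^ 2 + (2 * Real.pi * (k : ℕ)) ^ 2) : ℝ) : ℂ) := by
    intro k
    have hk : (0 : ℝ) < (k : ℕ) := by exact_mod_cast k.pos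
    have h1 : z - (k : ℕ) ≠ 0 := fun h => by
      have := congrArg Complex.im h
      simp at this
      linarith
    have h2 : z + (k : ℕ) ≠ 0 := fun h => by
      have := congrArg Complex.im h
      simp at this
      linarith
    have h3 : ((u : ℂ) ^ 2 + (2 * Real.pi * (k : ℕ)) ^ 2) ≠ 0 := by
      have : (u ^ 2 + (2 * Real.pi * (k : ℕ)) ^ 2 : ℝ) ≠ 0 := by positivity
      exact_mod_cast this
    have h4 : (z - (k : ℕ)) * (z + (k : ℕ)) =
        -((u : ℂ) ^ 2 + (2 * Real.pi * (k : ℕ)) ^ 2) / (2 * Real.pi) ^ 2 := by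
      rw [hz]
      field_simp
      ring_nf
      rw [Complex.I_sq]
      ring
    rw [div_add_div _ _ h1 h2, h4]
    push_cast
    rw [hz]
    field_simp
    ring
  rw [tsum_congr hterm, tsum_mul_left, ← Complex.ofReal_tsum, Complex.cot_eq_exp_ratio,
    hexp] at hcot
  rw [(summable_two_div_sq_add u).hasSum_iff]
  apply Complex.ofReal_injective
  set s : ℂ := ((∑' k : ℕ+, 2 / (u ^ 2 + (2 * Real.pi * (k : ℕ)) ^ 2) : ℝ) : ℂ) with hs
  rw [hz] at hcot
  push_cast
  apply mul_left_cancel₀ (a := -(2 * Real.pi * Complex.I * u)) (by simp [hpi, huC])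
  rw [← sub_eq_iff_eq_add'.2 hcot]
  field_simp
  rw [Complex.I_sq]
  ring

/-! ### The improper integral for a single exponential -/

lemma integral_exp_neg_mul {t : ℝ} (ht : t ≠ 0) (c : ℝ) :
    ∫ u in (0 : ℝ)..c, Real.exp (-(u * t)) = (1 - Real.exp (-(c * t))) / t := by
  have hderiv : ∀ u ∈ Set.uIcc (0 : ℝ) c, HasDerivAt
      (fun u => -(Real.exp (-(u * t)) / t)) (Real.exp (-(u * t))) u := by
    intro u _
    refine (((((hasDerivAt_id u).mul_const t).neg).exp).div_const t).neg.congr_deriv ?_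
    simp only [id, one_mul, Pi.neg_apply]
    field_simp
  rw [intervalIntegral.integral_eq_sub_of_hasDerivAt hderiv
    (Continuous.intervalIntegrable (by fun_prop) _ _)]
  simp only [zero_mul, neg_zero, Real.exp_zero]
  ring

/-- Fubini: integrating the truncated Laplace transform over `[0, c]` produces the kernel
`(1 - exp (-c t)) / t`. -/
lemma integral_sawtooth_div_mul_exp_sub_one (c T : ℝ) :
    ∫ t in (0 : ℝ)..T, sawtooth t / t * (Real.exp (-(c * t)) - 1) =
      -∫ u in (0 : ℝ)..c, truncatedLaplace u T := by
  have hswap : ∫ u in (0 : ℝ)..c, truncatedLaplace u T =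
      ∫ t in (0 : ℝ)..T, ∫ u in (0 : ℝ)..c, sawtooth t * Real.exp (-(u * t)) := by
    apply intervalIntegral_intervalIntegral_swap
    have hcompact : IntegrableOn (fun p : ℝ × ℝ => Real.exp (-(p.1 * p.2)))
        (Set.uIcc 0 c ×ˢ Set.uIcc 0 T) volume :=
      ContinuousOn.integrableOn_compact (isCompact_uIcc.prod isCompact_uIcc) (by fun_prop)
    refine (hcompact.mono_set
      (Set.prod_mono Set.uIoc_subset_uIcc Set.uIoc_subset_uIcc)).bdd_mul (c := 1 / 2)
      (measurable_sawtooth.comp measurable_snd).aestronglyMeasurable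
      (Eventually.of_forall fun p => abs_sawtooth_le p.2)
  rw [hswap, ← intervalIntegral.integral_neg]
  -- At `t = 0` the left integrand is the junk value `0`, so the integrands agree only off `0`.
  apply intervalIntegral.integral_congr_ae
  have h0 : ∀ᵐ t : ℝ, t ≠ 0 := by simp [ae_iff]
  filter_upwards [h0] with t ht _
  rw [intervalIntegral.integral_const_mul, integral_exp_neg_mul ht]
  ring

lemma measurable_truncatedLaplace_left {T : ℝ} (hT : 0 ≤ T) :
    Measurable fun u => truncatedLaplace u T := by
  simp only [truncatedLaplace, intervalIntegral.integral_of_le hT]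
  apply StronglyMeasurable.measurable
  apply StronglyMeasurable.integral_prod_right'
    (f := fun p : ℝ × ℝ => sawtooth p.2 * Real.exp (-(p.1 * p.2)))
  apply Measurable.stronglyMeasurable
  exact (measurable_sawtooth.comp measurable_snd).mul (by fun_prop)

/-- Linearity in `c` of this bound, uniform in `T`, is what makes the Möbius series of the truncated
integrals converge uniformly in `T`. -/
lemma abs_integral_sawtooth_div_mul_exp_sub_one_le {c T : ℝ} (hc : 0 ≤ c) (hT : 0 ≤ T) :
    |∫ t in (0 : ℝ)..T, sawtooth t / t * (Real.exp (-(c * t)) - 1)| ≤ c := by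
  rw [integral_sawtooth_div_mul_exp_sub_one, abs_neg, ← Real.norm_eq_abs]
  refine (intervalIntegral.norm_integral_le_of_norm_le_const (C := 1) fun u hu => ?_).trans ?_
  · rw [Set.uIoc_of_le hc] at hu
    exact abs_truncatedLaplace_le_one hu.1 hT
  · rw [sub_zero, abs_of_nonneg hc, one_mul]

lemma integral_two_div_sq_add_sq {b : ℝ} (hb : b ≠ 0) (c : ℝ) :
    ∫ u in (0 : ℝ)..c, 2 / (u ^ 2 + b ^ 2) = 2 / b * Real.arctan (c / b) := by
  have hderiv : ∀ u ∈ Set.uIcc (0 : ℝ) c, HasDerivAt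
      (fun u => 2 / b * Real.arctan (u / b)) (2 / (u ^ 2 + b ^ 2)) u := by
    intro u _
    refine ((((hasDerivAt_id u).div_const b).arctan).const_mul (2 / b)).congr_deriv ?_
    simp only [id]
    have : u ^ 2 + b ^ 2 ≠ 0 := by positivity
    field_simp
    ring
  rw [intervalIntegral.integral_eq_sub_of_hasDerivAt hderiv]
  · simp
  · refine (Continuous.div continuous_const (by fun_prop) fun u => ?_).intervalIntegrable _ _
    positivity

lemma integral_tsum_two_div_sq_add (c : ℝ) :
    ∫ u in (0 : ℝ)..c, ∑' k : ℕ+, 2 / (u ^ 2 + (2 * Real.pi * k) ^ 2) =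
      ∑' k : ℕ+, 1 / (Real.pi * k) * Real.arctan (c / (2 * Real.pi * k)) := by
  have h := intervalIntegral.hasSum_integral_of_dominated_convergence
    (μ := volume) (a := 0) (b := c)
    (F := fun (k : ℕ+) (u : ℝ) => 2 / (u ^ 2 + (2 * Real.pi * k) ^ 2))
    (f := fun u => ∑' k : ℕ+, 2 / (u ^ 2 + (2 * Real.pi * k) ^ 2))
    (fun k _ => 2 / ((0 : ℝ) ^ 2 + (2 * Real.pi * k) ^ 2))
    (fun k => (by fun_prop : Measurable _).aestronglyMeasurable)
    (fun k => Eventually.of_forall fun u _ => by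
      have hk : (0 : ℝ) < (k : ℕ) := by exact_mod_cast k.pos
      have hp := Real.pi_pos
      rw [Real.norm_eq_abs, abs_of_nonneg (by positivity)]
      refine div_le_div_of_nonneg_left (by norm_num) (by positivity) ?_
      nlinarith [sq_nonneg u])
    (Eventually.of_forall fun u _ => summable_two_div_sq_add 0)
    intervalIntegrable_const
    (Eventually.of_forall fun u _ => (summable_two_div_sq_add u).hasSum)
  rw [← h.tsum_eq]
  refine tsum_congr fun k => ?_
  have hk : (0 : ℝ) < (k : ℕ) := by exact_mod_cast k.pos
  have hp := Real.pi_pos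
  rw [integral_two_div_sq_add_sq (by positivity)]
  congr 1
  field_simp

lemma tendsto_integral_sawtooth_div_mul_exp_sub_one {c : ℝ} (hc : 0 ≤ c) :
    Tendsto (fun T : ℝ => ∫ t in (0 : ℝ)..T, sawtooth t / t * (Real.exp (-(c * t)) - 1)) atTop
      (𝓝 (∑' k : ℕ+, 1 / (Real.pi * k) * Real.arctan (c / (2 * Real.pi * k)))) := by
  simp_rw [integral_sawtooth_div_mul_exp_sub_one]
  rw [← integral_tsum_two_div_sq_add, ← neg_neg (∫ u in (0 : ℝ)..c, ∑' k : ℕ+, _),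
    ← intervalIntegral.integral_neg]
  refine Tendsto.neg (intervalIntegral.tendsto_integral_filter_of_dominated_convergence
    (fun _ => (1 : ℝ)) ?_ ?_ intervalIntegrable_const ?_)
  · filter_upwards [eventually_ge_atTop 0] with T hT
    exact (measurable_truncatedLaplace_left hT).aestronglyMeasurable
  · filter_upwards [eventually_ge_atTop 0] with T hT
    refine Eventually.of_forall fun u hu => ?_
    rw [Set.uIoc_of_le hc] at hu
    exact abs_truncatedLaplace_le_one hu.1 hT
  · refine Eventually.of_forall fun u hu => ?_
    rw [Set.uIoc_of_le hc] at hu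
    rw [(hasSum_two_div_sq_add hu.1).tsum_eq, neg_sub]
    exact tendsto_truncatedLaplace hu.1

/-! ### Möbius inversion of the double series -/

lemma sum_divisorsAntidiagonal_moebius (n : ℕ) :
    ∑ d ∈ n.divisorsAntidiagonal, (ArithmeticFunction.moebius d.1 : ℝ) =
      if n = 1 then 1 else 0 := by
  rw [← ArithmeticFunction.one_apply, ← ArithmeticFunction.coe_moebius_mul_coe_zeta,
    ArithmeticFunction.coe_mul_zeta_apply, Nat.sum_divisorsAntidiagonal
      (fun i _ => (ArithmeticFunction.moebius i : ℝ))]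
  rfl

lemma abs_moebius_cast_le_one (n : ℕ) : |(ArithmeticFunction.moebius n : ℝ)| ≤ 1 := by
  exact_mod_cast ArithmeticFunction.abs_moebius_le_one (n := n)

/-- Möbius inversion for sums over multiples: the terms with `n k = m` cancel unless `m = 1`. -/
lemma tsum_moebius_mul_tsum {f : ℕ → ℝ}
    (hf : Summable fun p : ℕ+ × ℕ+ => |f (p.1 * p.2)|) :
    ∑' n : ℕ+, (ArithmeticFunction.moebius n : ℝ) * ∑' k : ℕ+, f (n * k) = f 1 := by
  set g : ℕ+ × ℕ+ → ℝ := fun p => (ArithmeticFunction.moebius p.1 : ℝ) * f (p.1 * p.2) with hg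
  have hsum : Summable g := by
    refine Summable.of_norm_bounded hf fun p => ?_
    rw [hg, norm_mul, Real.norm_eq_abs, Real.norm_eq_abs]
    exact mul_le_of_le_one_left (abs_nonneg _) (abs_moebius_cast_le_one _)
  have hsum' := sigmaAntidiagonalEquivProd.summable_iff.2 hsum
  simp_rw [← tsum_mul_left]
  rw [← hsum.tsum_prod, ← sigmaAntidiagonalEquivProd.tsum_eq g]
  have hfiber : ∀ n : ℕ+, ∑' x : (n : ℕ).divisorsAntidiagonal,
      g (sigmaAntidiagonalEquivProd ⟨n, x⟩) = if (n : ℕ) = 1 then f 1 else 0 := by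
    intro n
    rw [tsum_fintype]
    calc ∑ x : (n : ℕ).divisorsAntidiagonal, g (sigmaAntidiagonalEquivProd ⟨n, x⟩)
        = ∑ x : (n : ℕ).divisorsAntidiagonal,
            (ArithmeticFunction.moebius x.1.1 : ℝ) * f n := by
          refine Finset.sum_congr rfl fun x _ => ?_
          have hx := (Nat.mem_divisorsAntidiagonal.1 x.2).1
          simp [hg, sigmaAntidiagonalEquivProd, divisorsAntidiagonalFactors, hx]
      _ = (∑ d ∈ (n : ℕ).divisorsAntidiagonal, (ArithmeticFunction.moebius d.1 : ℝ)) * f n := by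
          rw [Finset.sum_mul]
          exact Finset.sum_coe_sort (n : ℕ).divisorsAntidiagonal
            fun d => (ArithmeticFunction.moebius d.1 : ℝ) * f n
      _ = if (n : ℕ) = 1 then f 1 else 0 := by
          rw [sum_divisorsAntidiagonal_moebius]
          split_ifs with h <;> simp [h]
  rw [Summable.tsum_sigma (f := fun x => g (sigmaAntidiagonalEquivProd x)) hsum',
    tsum_congr hfiber, tsum_eq_single 1]
  · simp
  · intro n hn
    simp [hn]

/-- The sum over all `n` of the limits attached to `c = 1 / (n a)`. -/
lemma tsum_moebius_mul_tsum_arctan {a : ℝ} (ha : 0 < a) :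
    ∑' n : ℕ+, (ArithmeticFunction.moebius n : ℝ) / n *
        ∑' k : ℕ+, 1 / (Real.pi * k) * Real.arctan (1 / (n * a) / (2 * Real.pi * k)) =
      1 / Real.pi * Real.arctan (1 / (2 * Real.pi * a)) := by
  have hpi := Real.pi_pos
  set f : ℕ → ℝ := fun m => 1 / (Real.pi * m) * Real.arctan (1 / (2 * Real.pi * a * m)) with hf
  have hbound : ∀ m : ℕ, 0 < m → |f m| ≤ 1 / (2 * Real.pi ^ 2 * a) * (1 / (m : ℝ) ^ 2) := by
    intro m hm
    have hm' : (0 : ℝ) < m := by exact_mod_cast hm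
    have harc : |Real.arctan (1 / (2 * Real.pi * a * m))| ≤ 1 / (2 * Real.pi * a * m) := by
      rw [abs_of_nonneg (Real.arctan_nonneg.2 (by positivity))]
      simpa only [Real.tan_arctan] using
        Real.le_tan (Real.arctan_nonneg.2 (by positivity)) (Real.arctan_lt_pi_div_two _)
    rw [hf, abs_mul, abs_of_nonneg (by positivity)]
    calc 1 / (Real.pi * m) * |Real.arctan (1 / (2 * Real.pi * a * m))|
        ≤ 1 / (Real.pi * m) * (1 / (2 * Real.pi * a * m)) := by gcongr
      _ = _ := by field_simp
  have hsq : Summable fun n : ℕ+ => 1 / ((n : ℕ) : ℝ) ^ 2 :=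
    (Real.summable_one_div_nat_pow.2 one_lt_two).comp_injective PNat.coe_injective
  have hsum : Summable fun p : ℕ+ × ℕ+ => |f (p.1 * p.2)| := by
    have hprod := (hsq.mul_of_nonneg hsq (fun n => by positivity)
      (fun n => by positivity)).mul_left (1 / (2 * Real.pi ^ 2 * a))
    refine hprod.of_nonneg_of_le (fun p => abs_nonneg _) fun p => ?_
    refine (hbound _ (Nat.mul_pos p.1.pos p.2.pos)).trans_eq ?_
    push_cast
    rw [one_div_mul_one_div (_ ^ 2), mul_pow]
  have h := tsum_moebius_mul_tsum hsum
  rw [hf] at h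
  simp only [Nat.cast_one, mul_one] at h
  rw [← h]
  refine tsum_congr fun n => ?_
  rw [div_mul_eq_mul_div, mul_div_assoc, ← tsum_div_const]
  congr 1
  refine tsum_congr fun k => ?_
  have hn : (0 : ℝ) < (n : ℕ) := by exact_mod_cast n.pos
  have hk : (0 : ℝ) < (k : ℕ) := by exact_mod_cast k.pos
  push_cast
  rw [div_div, show (n : ℝ) * a * (2 * Real.pi * k) = 2 * Real.pi * a * (n * k) by ring]
  field_simp

/-! ### The Laplace transform of the sine integral -/

/-- The integral form of `x ↦ Si (b x)` as a function of the dilation parameter. -/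
lemma sineIntegral_mul (b x : ℝ) :
    sineIntegral (b * x) = ∫ v in (0 : ℝ)..b, x * (Real.sin (v * x) / (v * x)) := by
  have h := intervalIntegral.mul_integral_comp_mul_right (a := 0) (b := b)
    (f := fun u => Real.sin u / u) x
  rw [zero_mul] at h
  rw [sineIntegral, intervalIntegral.integral_const_mul, ← h]

lemma abs_mul_sin_div_le (v x : ℝ) : |x * (Real.sin (v * x) / (v * x))| ≤ |x| := by
  rw [abs_mul, abs_div]
  exact mul_le_of_le_one_right (abs_nonneg x) (div_le_one_of_le₀ Real.abs_sin_le_abs (abs_nonneg _))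

lemma integrableOn_mul_exp_neg : IntegrableOn (fun x : ℝ => x * Real.exp (-x)) (Set.Ioi 0) := by
  have h := Real.GammaIntegral_convergent (s := 2) two_pos
  refine h.congr_fun (fun x _ => ?_) measurableSet_Ioi
  norm_num [mul_comm]

lemma integral_exp_neg_mul_sin (v : ℝ) :
    ∫ x in Set.Ioi (0 : ℝ), Real.exp (-x) * Real.sin (v * x) = v / (1 + v ^ 2) := by
  have hv : 1 + v ^ 2 ≠ 0 := by positivity
  have hderiv : ∀ x ∈ Set.Ici (0 : ℝ), HasDerivAt
      (fun x => -(Real.exp (-x) * (Real.sin (v * x) + v * Real.cos (v * x))) / (1 + v ^ 2))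
      (Real.exp (-x) * Real.sin (v * x)) x := by
    intro x _
    have hlin : HasDerivAt (fun x : ℝ => v * x) (v * 1) x := (hasDerivAt_id x).const_mul v
    have hexp : HasDerivAt (fun x : ℝ => Real.exp (-x)) (Real.exp (-x) * -1) x :=
      ((hasDerivAt_id x).neg).exp
    refine ((hexp.mul (hlin.sin.add (hlin.cos.const_mul v))).neg.div_const _).congr_deriv ?_
    simp only [Pi.add_apply]
    field_simp
    ring
  have hint : IntegrableOn (fun x : ℝ => Real.exp (-x) * Real.sin (v * x)) (Set.Ioi 0) := by
    refine (integrableOn_exp_neg_Ioi 0).mul_bdd (c := 1)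
      (by fun_prop : Measurable _).aestronglyMeasurable
      (Eventually.of_forall fun x => Real.abs_sin_le_one _)
  have hlim : Tendsto
      (fun x => -(Real.exp (-x) * (Real.sin (v * x) + v * Real.cos (v * x))) / (1 + v ^ 2))
      atTop (𝓝 0) := by
    have hbdd : Tendsto (fun x : ℝ => Real.exp (-x) * (Real.sin (v * x) + v * Real.cos (v * x)))
        atTop (𝓝 0) := by
      refine squeeze_zero_norm (a := fun x => Real.exp (-x) * (1 + |v|)) (fun x => ?_) ?_
      · rw [norm_mul, Real.norm_eq_abs, Real.norm_eq_abs, Real.abs_exp]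
        gcongr
        refine (abs_add_le _ _).trans (add_le_add (Real.abs_sin_le_one _) ?_)
        rw [abs_mul]
        exact mul_le_of_le_one_right (abs_nonneg v) (Real.abs_cos_le_one _)
      · simpa using Real.tendsto_exp_neg_atTop_nhds_zero.mul_const (1 + |v|)
    simpa using hbdd.neg.div_const (1 + v ^ 2)
  rw [integral_Ioi_of_hasDerivAt_of_tendsto' hderiv hint hlim]
  simp [neg_div]

/-- Integrability for Fubini: the kernel is dominated by `x * exp (-x)`, uniformly in `v`. -/
lemma integrable_sin_kernel (b : ℝ) :
    Integrable (fun p : ℝ × ℝ => p.2 * (Real.sin (p.1 * p.2) / (p.1 * p.2)) * Real.exp (-p.2))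
      ((volume.restrict (Set.uIoc 0 b)).prod (volume.restrict (Set.Ioi 0))) := by
  have hdom : Integrable (fun p : ℝ × ℝ => (1 : ℝ) * (p.2 * Real.exp (-p.2)))
      ((volume.restrict (Set.uIoc 0 b)).prod (volume.restrict (Set.Ioi 0))) :=
    Integrable.mul_prod (f := fun _ => (1 : ℝ)) (integrableOn_const (by simp))
      integrableOn_mul_exp_neg
  refine hdom.mono (by fun_prop : Measurable _).aestronglyMeasurable
    (Eventually.of_forall fun p => ?_)
  rw [one_mul, norm_mul, norm_mul p.2 (Real.exp _)]
  exact mul_le_mul_of_nonneg_right (abs_mul_sin_div_le _ _) (norm_nonneg _)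

lemma sineIntegral_mul_exp_neg (b x : ℝ) :
    sineIntegral (b * x) * Real.exp (-x) =
      ∫ v in (0 : ℝ)..b, x * (Real.sin (v * x) / (v * x)) * Real.exp (-x) := by
  rw [intervalIntegral.integral_mul_const, sineIntegral_mul]

lemma integrableOn_sineIntegral_mul_exp_neg {b : ℝ} (hb : 0 ≤ b) :
    IntegrableOn (fun x : ℝ => sineIntegral (b * x) * Real.exp (-x)) (Set.Ioi 0) := by
  simp_rw [sineIntegral_mul_exp_neg, intervalIntegral.integral_of_le hb, ← Set.uIoc_of_le hb]
  exact (integrable_sin_kernel b).integral_prod_right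

/-- The Laplace transform of the sine integral, evaluated at `1` after a dilation. -/
lemma integral_sineIntegral_mul_exp_neg (b : ℝ) :
    ∫ x in Set.Ioi (0 : ℝ), sineIntegral (b * x) * Real.exp (-x) = Real.arctan b := by
  simp_rw [sineIntegral_mul_exp_neg]
  rw [← intervalIntegral_integral_swap (integrable_sin_kernel b),
    show Real.arctan b = ∫ v in (0 : ℝ)..b, 1 / (1 + v ^ 2) by simp]
  -- At `v = 0` the quotient `sin (v x) / (v x)` is `0` in place of its limit `1`.
  apply intervalIntegral.integral_congr_ae
  have h0 : ∀ᵐ v : ℝ, v ≠ 0 := by simp [ae_iff]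
  filter_upwards [h0] with v hv _
  calc ∫ x in Set.Ioi (0 : ℝ), x * (Real.sin (v * x) / (v * x)) * Real.exp (-x)
      = ∫ x in Set.Ioi (0 : ℝ), 1 / v * (Real.exp (-x) * Real.sin (v * x)) := by
        refine setIntegral_congr_fun measurableSet_Ioi fun x hx => ?_
        have hx0 : x ≠ 0 := ne_of_gt hx
        field_simp
    _ = 1 / (1 + v ^ 2) := by
        rw [integral_const_mul, integral_exp_neg_mul_sin]
        field_simp

/-! ### The Möbius series under the integral -/

lemma moebiusExpTerm_eq (a t : ℝ) (n : ℕ+) :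
    moebiusExpTerm a t n = (ArithmeticFunction.moebius n : ℝ) / n *
      (Real.exp (-(1 / (n * a) * t)) - 1) := by
  rw [moebiusExpTerm]
  congr 4
  ring

lemma abs_moebiusExpTerm_le {a t : ℝ} (ha : 0 < a) (ht : 0 ≤ t) (n : ℕ+) :
    |moebiusExpTerm a t n| ≤ t * (1 / a * (1 / ((n : ℕ) : ℝ) ^ 2)) := by
  have hn : (0 : ℝ) < (n : ℕ) := by exact_mod_cast n.pos
  have hc : 0 ≤ 1 / ((n : ℕ) * a) * t := by positivity
  have h1 : Real.exp (-(1 / ((n : ℕ) * a) * t)) ≤ 1 := Real.exp_le_one_iff.2 (by linarith)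
  have h2 := Real.add_one_le_exp (-(1 / ((n : ℕ) * a) * t))
  rw [moebiusExpTerm_eq, abs_mul, abs_div, abs_of_pos hn,
    abs_of_nonpos (sub_nonpos.2 h1)]
  calc |(ArithmeticFunction.moebius n : ℝ)| / (n : ℕ) *
        -(Real.exp (-(1 / ((n : ℕ) * a) * t)) - 1)
      ≤ 1 / (n : ℕ) * (1 / ((n : ℕ) * a) * t) := by
        apply mul_le_mul _ (by linarith) (by linarith) (by positivity)
        exact div_le_div_of_nonneg_right (abs_moebius_cast_le_one n) hn.le
    _ = _ := by field_simp

lemma summable_one_div_mul_one_div_sq (a : ℝ) :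
    Summable fun n : ℕ+ => 1 / a * (1 / ((n : ℕ) : ℝ) ^ 2) :=
  ((Real.summable_one_div_nat_pow.2 one_lt_two).comp_injective PNat.coe_injective).mul_left _

lemma summable_moebiusExpTerm {a t : ℝ} (ha : 0 < a) (ht : 0 ≤ t) :
    Summable (moebiusExpTerm a t) :=
  Summable.of_norm_bounded ((summable_one_div_mul_one_div_sq a).mul_left t)
    fun n => abs_moebiusExpTerm_le ha ht n

lemma continuousOn_tsum_moebiusExpTerm {a : ℝ} (ha : 0 < a) (T : ℝ) :
    ContinuousOn (fun t => ∑' n : ℕ+, moebiusExpTerm a t n) (Set.Icc 0 T) := by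
  refine continuousOn_tsum (fun n => ?_) ((summable_one_div_mul_one_div_sq a).mul_left T)
    fun n t ht => (abs_moebiusExpTerm_le ha ht.1 n).trans ?_
  · unfold moebiusExpTerm
    fun_prop
  · exact mul_le_mul_of_nonneg_right ht.2 (by positivity)

lemma abs_sawtooth_div_mul_moebiusExpTerm_le {a t : ℝ} (ha : 0 < a) (ht : 0 < t) (n : ℕ+) :
    |sawtooth t / t * moebiusExpTerm a t n| ≤ 1 / a * (1 / ((n : ℕ) : ℝ) ^ 2) := by
  rw [abs_mul, abs_div, abs_of_pos ht]
  calc |sawtooth t| / t * |moebiusExpTerm a t n|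
      ≤ 1 / t * (t * (1 / a * (1 / ((n : ℕ) : ℝ) ^ 2))) := by
        refine mul_le_mul ?_ (abs_moebiusExpTerm_le ha ht.le n) (abs_nonneg _) (by positivity)
        exact div_le_div_of_nonneg_right ((abs_sawtooth_le t).trans (by norm_num)) ht.le
    _ = _ := by field_simp

lemma intervalIntegrable_sawtooth_div_mul_tsum {a : ℝ} (ha : 0 < a) {T : ℝ} (hT : 0 ≤ T) :
    IntervalIntegrable (fun t => sawtooth t / t * ∑' n : ℕ+, moebiusExpTerm a t n)
      volume 0 T := by
  rw [intervalIntegrable_iff_integrableOn_Ioc_of_le hT]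
  have hmeas : AEStronglyMeasurable (fun t => sawtooth t / t * ∑' n : ℕ+, moebiusExpTerm a t n)
      (volume.restrict (Set.Ioc 0 T)) :=
    (measurable_sawtooth.div measurable_id).aestronglyMeasurable.mul
      (((continuousOn_tsum_moebiusExpTerm ha T).mono Set.Ioc_subset_Icc_self).aestronglyMeasurable
        measurableSet_Ioc)
  refine IntegrableOn.of_bound (by simp) hmeas
    (∑' n : ℕ+, 1 / a * (1 / ((n : ℕ) : ℝ) ^ 2)) ?_
  filter_upwards [ae_restrict_mem measurableSet_Ioc] with t ht
  rw [← tsum_mul_left]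
  exact tsum_of_norm_bounded (summable_one_div_mul_one_div_sq a).hasSum
    fun n => abs_sawtooth_div_mul_moebiusExpTerm_le ha ht.1 n

lemma integral_sawtooth_div_mul_tsum {a : ℝ} (ha : 0 < a) {T : ℝ} (hT : 0 ≤ T) :
    ∫ t in (0 : ℝ)..T, sawtooth t / t * ∑' n : ℕ+, moebiusExpTerm a t n =
      ∑' n : ℕ+, (ArithmeticFunction.moebius n : ℝ) / n *
        ∫ t in (0 : ℝ)..T, sawtooth t / t * (Real.exp (-(1 / (n * a) * t)) - 1) := by
  have h := intervalIntegral.hasSum_integral_of_dominated_convergence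
    (μ := volume) (a := 0) (b := T)
    (F := fun (n : ℕ+) (t : ℝ) => sawtooth t / t * moebiusExpTerm a t n)
    (f := fun t => sawtooth t / t * ∑' n : ℕ+, moebiusExpTerm a t n)
    (fun n _ => 1 / a * (1 / ((n : ℕ) : ℝ) ^ 2))
    (fun n => by
      unfold moebiusExpTerm
      exact ((measurable_sawtooth.div measurable_id).mul
        (by fun_prop : Measurable _)).aestronglyMeasurable)
    (fun n => Eventually.of_forall fun t ht => by
      rw [Set.uIoc_of_le hT] at ht
      exact abs_sawtooth_div_mul_moebiusExpTerm_le ha ht.1 n)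
    (Eventually.of_forall fun t _ => summable_one_div_mul_one_div_sq a)
    intervalIntegrable_const
    (Eventually.of_forall fun t ht => by
      rw [Set.uIoc_of_le hT] at ht
      exact (summable_moebiusExpTerm ha ht.1.le).hasSum.mul_left _)
  rw [← h.tsum_eq]
  refine tsum_congr fun n => ?_
  rw [← intervalIntegral.integral_const_mul]
  congr 1
  ext t
  rw [moebiusExpTerm_eq]
  ring

lemma tendsto_integral_sawtooth_div_mul_tsum {a : ℝ} (ha : 0 < a) :
    Tendsto (fun T : ℝ =>
        ∫ t in (0 : ℝ)..T, sawtooth t / t * ∑' n : ℕ+, moebiusExpTerm a t n) atTop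
      (𝓝 (1 / Real.pi * Real.arctan (1 / (2 * Real.pi * a)))) := by
  rw [← tsum_moebius_mul_tsum_arctan ha]
  have hlim : Tendsto (fun T : ℝ => ∑' n : ℕ+, (ArithmeticFunction.moebius n : ℝ) / n *
        ∫ t in (0 : ℝ)..T, sawtooth t / t * (Real.exp (-(1 / (n * a) * t)) - 1)) atTop
      (𝓝 (∑' n : ℕ+, (ArithmeticFunction.moebius n : ℝ) / n *
        ∑' k : ℕ+, 1 / (Real.pi * k) * Real.arctan (1 / (n * a) / (2 * Real.pi * k)))) := by
    refine tendsto_tsum_of_dominated_convergence (summable_one_div_mul_one_div_sq a)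
      (fun n => (tendsto_integral_sawtooth_div_mul_exp_sub_one (by positivity)).const_mul _) ?_
    filter_upwards [eventually_ge_atTop 0] with T hT n
    have hn : (0 : ℝ) < (n : ℕ) := by exact_mod_cast n.pos
    rw [norm_mul, norm_div, Real.norm_eq_abs, Real.norm_eq_abs, Real.norm_eq_abs, abs_of_pos hn]
    calc _ ≤ 1 / ((n : ℕ) : ℝ) * (1 / ((n : ℕ) * a)) :=
          mul_le_mul (div_le_div_of_nonneg_right (abs_moebius_cast_le_one n) hn.le)
            (abs_integral_sawtooth_div_mul_exp_sub_one_le (by positivity) hT)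
            (abs_nonneg _) (by positivity)
      _ = _ := by field_simp
  refine hlim.congr' ?_
  filter_upwards [eventually_ge_atTop 0] with T hT
  exact (integral_sawtooth_div_mul_tsum ha hT).symm

theorem theorem4p2 (a : ℝ) (ha : 0 < a) :
    (∀ t : ℝ, 0 < t → Summable (moebiusExpTerm a t)) ∧
    IntegrableOn (fun x : ℝ => sineIntegral (x / (2 * Real.pi * a)) * Real.exp (-x))
      (Set.Ioi 0) volume ∧
    HasImproperIntegral
      (fun t : ℝ => (Int.fract t - 1 / 2) / t * ∑' n : ℕ+, moebiusExpTerm a t n)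
      (1 / Real.pi *
        ∫ x in Set.Ioi (0 : ℝ), sineIntegral (x / (2 * Real.pi * a)) * Real.exp (-x)) := by
  have hpi := Real.pi_pos
  have hdil : (fun x : ℝ => sineIntegral (x / (2 * Real.pi * a)) * Real.exp (-x)) =
      fun x => sineIntegral (1 / (2 * Real.pi * a) * x) * Real.exp (-x) := by
    ext x
    rw [one_div_mul_eq_div]
  rw [hdil]
  refine ⟨fun t ht => summable_moebiusExpTerm ha ht.le,
    integrableOn_sineIntegral_mul_exp_neg (by positivity),
    fun T hT => intervalIntegrable_sawtooth_div_mul_tsum ha hT.le, ?_⟩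
  rw [integral_sineIntegral_mul_exp_neg]
  exact tendsto_integral_sawtooth_div_mul_tsum ha
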